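/- For $n\ge 2$, Page parking on $\{1,\dots,n\}$ is the following random process. Let $U_0,U_1,U_2,\dots$ be independent random variables, each uniform on $\{1,\dots,n-1\}$. Start from the empty configuration $x^0=(0,\dots,0)\in\{0,1\}^n$. Given $x^t$, put $i=U_t$: if $x^t_i=x^t_{i+1}=0$, a car parks at $(i,i+1)$, that is, $x^{t+1}_i=x^{t+1}_{i+1}=1$ and the other coordinates are unchanged; otherwise $x^{t+1}=x^t$. Let $T_n$ be the first $t$ such that no two adjacent places $i,i+1$ satisfy $x^t_i=x^t_{i+1}=0$, and let $M_n=\#\{1\le i\le n:\ x^{T_n}_i=1\}$ be the number of occupied places in the final configuration. Theorem. For every $n\ge 2$, the time $T_n$ is almost surely finite, $M_n$ is integrable, and $$\bigl|\mathbb{E}[M_n]-n(1-e^{-2})\bigr|\le 12 .$$ Consequently (Page's theorem) $$\lim_{n\to\infty}\frac{\mathbb{E}[M_n]}{n}=1-e^{-2}.$$ -/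

import Mathlib

open MeasureTheory ProbabilityTheory Filter Topology

namespace PageParking

/-- A parking configuration: `x i = true` when place `i` is occupied by a car, `x i = false` when it
is empty. For the parking on `{1, …, n}` only the coordinates `1, …, n` matter; the others are
never changed from their initial value `false`. -/
abbrev Config : Type := ℕ → Bool

/-- A car of size two can park at `i` in the parking `{1, …, n}`: both `i` and `i + 1` are places of
the parking, and both are empty. -/
def CanPark (n : ℕ) (x : Config) (i : ℕ) : Prop :=
  (1 ≤ i ∧ i + 1 ≤ n) ∧ x i = false ∧ x (i + 1) = false

open Classical in
/-- One step of the dynamics: a car tries to park at `i`, on the places `i` and `i + 1`, and does so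
if this is possible; all other coordinates remain unchanged. -/
noncomputable def parkStep (n : ℕ) (x : Config) (i : ℕ) : Config :=
  if CanPark n x i then fun j => if j = i ∨ j = i + 1 then true else x j else x

/-- The configuration `x ^ t` produced by the draws `u 0, u 1, …`, starting from the empty parking;
`u t` is the draw that leads from `x ^ t` to `x ^ (t + 1)`. -/
noncomputable def config (n : ℕ) (u : ℕ → ℕ) : ℕ → Config
  | 0 => fun _ => false
  | t + 1 => parkStep n (config n u t) (u t)

/-- Parking is no more possible: there is no pair of adjacent empty places. -/
def IsFull (n : ℕ) (x : Config) : Prop := ∀ i, ¬ CanPark n x i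

/-- The first time at which parking is no more possible. (It is given the value `0` if there is no
such time; for uniform independent draws this has probability zero, as is part of the theorem.) -/
noncomputable def finalTime (n : ℕ) (u : ℕ → ℕ) : ℕ := sInf {t | IsFull n (config n u t)}

/-- The final configuration. -/
noncomputable def finalConfig (n : ℕ) (u : ℕ → ℕ) : Config := config n u (finalTime n u)

/-- The number of places in `{1, …, n}` that are occupied by a car in the final configuration. -/
noncomputable def occupied (n : ℕ) (u : ℕ → ℕ) : ℕ :=
  ((Finset.Icc 1 n).filter fun i => finalConfig n u i = true).card

/-- `U 0, U 1, …` are independent random variables on the probability space `(Ω, P)`, each uniformly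
distributed on `{1, …, n - 1}`. -/
structure IsUniformDraws {Ω : Type*} [MeasurableSpace Ω] (n : ℕ) (P : Measure Ω)
    (U : ℕ → Ω → ℕ) : Prop where
  measurable : ∀ t, Measurable (U t)
  indep : iIndepFun U P
  uniform : ∀ t, P.map (U t) = uniformOn (Set.Icc 1 (n - 1))

end PageParking

namespace PageParking

/-! Let R_l(x) be the number of runs of l consecutive empty places. A car can cut a given run of
length k+1 from k interior positions, or from either end exactly when the run extended by one place
on that side is empty. Hence the R_l satisfy a triangular system (`sum_runCount_parkStep_sub`), and
Φ = ∑ (-2)^k/k! R_{k+1} is harmonic for the dynamics (`sum_emptyPotential_parkStep_sub`). On a full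
configuration only R_1 survives in Φ, and it counts the empty places. Full configurations are
reached almost surely (`ae_exists_isFull`), so dominated convergence gives E[n - M_n] = Φ(empty) =
∑_{k<n} (-2)^k/k! (n - k) exactly (`integral_occupied`). This differs from n e^{-2} by a bounded
amount, being a truncated exponential series (`abs_mul_exp_sub_sum_le`). -/

/-! ### Runs of empty places and the effect of one parking step -/

/-- The `l` places from `j` on belong to the parking `{1, …, n}` and are all empty. -/
def EmptyRun (n : ℕ) (x : Config) (j l : ℕ) : Prop :=
  1 ≤ j ∧ j + l ≤ n + 1 ∧ ∀ i, j ≤ i → i < j + l → x i = false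

open Classical in
/-- The indicator of `EmptyRun`. -/
noncomputable def runInd (n : ℕ) (x : Config) (j l : ℕ) : ℝ :=
  if EmptyRun n x j l then 1 else 0

/-- The number of (not necessarily maximal) runs of `l` empty places. -/
noncomputable def runCount (n : ℕ) (x : Config) (l : ℕ) : ℝ :=
  ∑ j ∈ Finset.range (n + 1), runInd n x j l

lemma canPark_iff_emptyRun {n : ℕ} {x : Config} {i : ℕ} : CanPark n x i ↔ EmptyRun n x i 2 := by
  constructor
  · rintro ⟨⟨h1, h2⟩, h3, h4⟩
    refine ⟨h1, by omega, fun j hj hj' => ?_⟩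
    obtain rfl | rfl : j = i ∨ j = i + 1 := by omega
    · exact h3
    · exact h4
  · rintro ⟨h1, h2, h3⟩
    exact ⟨⟨h1, by omega⟩, h3 i le_rfl (by omega), h3 (i + 1) (by omega) (by omega)⟩

lemma EmptyRun.mono {n : ℕ} {x : Config} {j l j' l' : ℕ} (h : EmptyRun n x j l) (hj : j ≤ j')
    (hl : j' + l' ≤ j + l) : EmptyRun n x j' l' :=
  ⟨hj.trans' h.1, hl.trans h.2.1, fun i hi hi' => h.2.2 i (hj.trans hi) (hi'.trans_le hl)⟩

lemma EmptyRun.union {n : ℕ} {x : Config} {j l j' l' m : ℕ} (h : EmptyRun n x j l)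
    (h' : EmptyRun n x j' l') (hj : j' ≤ j + l) (hm : j + m ≤ j' + l') :
    EmptyRun n x j m :=
  ⟨h.1, hm.trans h'.2.1, fun i hi hi' => by
    by_cases hil : i < j + l
    · exact h.2.2 i hi hil
    · exact h'.2.2 i (by omega) (by omega)⟩

lemma emptyRun_parkStep {n : ℕ} {x : Config} {i j l : ℕ} (h : CanPark n x i) :
    EmptyRun n (parkStep n x i) j l ↔ EmptyRun n x j l ∧ (i + 1 < j ∨ j + l ≤ i ∨ l = 0) := by
  simp only [parkStep, if_pos h, EmptyRun]
  constructor
  · rintro ⟨h1, h2, h3⟩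
    refine ⟨⟨h1, h2, fun m hm hm' => ?_⟩, ?_⟩
    · have := h3 m hm hm'
      split_ifs at this
      exact this
    · by_contra! hc
      by_cases hij : i < j
      · have := h3 j le_rfl (by omega)
        rw [if_pos (by omega)] at this
        cases this
      · have := h3 i (by omega) (by omega)
        rw [if_pos (by omega)] at this
        cases this
  · rintro ⟨⟨h1, h2, h3⟩, h4⟩
    refine ⟨h1, h2, fun m hm hm' => ?_⟩
    rw [if_neg (by omega)]
    exact h3 m hm hm'

/-- The three terms are the ways {i, i+1} can meet the run: inside it, at its left end, at its right
end. In the end cases the car fits exactly when the run lengthened by one place is empty. If the car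
does not fit, every term vanishes, since each run involved would contain the pair. -/
lemma runInd_sub_parkStep (n : ℕ) (x : Config) (i j k : ℕ) :
    runInd n x j (k + 1) - runInd n (parkStep n x i) j (k + 1) =
      (if j ≤ i ∧ i < j + k then runInd n x j (k + 1) else 0)
        + (if i + 1 = j then runInd n x i (k + 2) else 0)
        + (if i = j + k then runInd n x j (k + 2) else 0) := by
  by_cases h : CanPark n x i
  · have hr := canPark_iff_emptyRun.1 h
    have h1 : i + 1 = j → (EmptyRun n x i (k + 2) ↔ EmptyRun n x j (k + 1)) := fun e =>
      ⟨fun h' => h'.mono (by omega) (by omega), fun h' => hr.union h' (by omega) (by omega)⟩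
    have h2 : i = j + k → (EmptyRun n x j (k + 2) ↔ EmptyRun n x j (k + 1)) := fun e =>
      ⟨fun h' => h'.mono (by omega) (by omega), fun h' => h'.union hr (by omega) (by omega)⟩
    have h0 := emptyRun_parkStep (j := j) (l := k + 1) h
    simp only [runInd]
    by_cases hj : EmptyRun n x j (k + 1)
    · by_cases hs : EmptyRun n (parkStep n x i) j (k + 1)
      · have := (h0.1 hs).2
        rw [if_pos hj, if_pos hs, if_neg (by omega), if_neg (by omega), if_neg (by omega)]
        norm_num
      · have : ¬ (i + 1 < j ∨ j + (k + 1) ≤ i ∨ k + 1 = 0) := fun e => hs (h0.2 ⟨hj, e⟩)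
        rw [if_pos hj, if_neg hs]
        by_cases e1 : i + 1 = j
        · rw [if_neg (by omega), if_pos e1, if_pos ((h1 e1).2 hj), if_neg (by omega)]
          norm_num
        by_cases e2 : i = j + k
        · rw [if_neg (by omega), if_neg e1, if_pos e2, if_pos ((h2 e2).2 hj)]
          norm_num
        · rw [if_pos (by omega), if_neg e1, if_neg e2]
          norm_num
    · have hs : ¬ EmptyRun n (parkStep n x i) j (k + 1) := fun hs => hj (h0.1 hs).1
      rw [if_neg hj, if_neg hs, ite_self]
      by_cases e1 : i + 1 = j
      · rw [if_pos e1, if_neg (mt (h1 e1).1 hj), if_neg (by omega)]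
        norm_num
      by_cases e2 : i = j + k
      · rw [if_neg e1, if_pos e2, if_neg (mt (h2 e2).1 hj)]
        norm_num
      · rw [if_neg e1, if_neg e2]
        norm_num
  · have hr := fun h' => h (canPark_iff_emptyRun.2 h')
    have h0 : j ≤ i ∧ i < j + k → ¬ EmptyRun n x j (k + 1) := fun e h' =>
      hr (h'.mono (by omega) (by omega))
    have h1 : i + 1 = j → ¬ EmptyRun n x i (k + 2) := fun e h' =>
      hr (h'.mono (by omega) (by omega))
    have h2 : i = j + k → ¬ EmptyRun n x j (k + 2) := fun e h' =>
      hr (h'.mono (by omega) (by omega))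
    have e1 : (if j ≤ i ∧ i < j + k then runInd n x j (k + 1) else 0) = 0 := by
      split_ifs with e
      · exact if_neg (h0 e)
      · rfl
    have e2 : (if i + 1 = j then runInd n x i (k + 2) else 0) = 0 := by
      split_ifs with e
      · exact if_neg (h1 e)
      · rfl
    have e3 : (if i = j + k then runInd n x j (k + 2) else 0) = 0 := by
      split_ifs with e
      · exact if_neg (h2 e)
      · rfl
    rw [e1, e2, e3, parkStep, if_neg h]
    simp

lemma runInd_eq_zero {n : ℕ} {x : Config} {j l : ℕ} (h : ¬ (1 ≤ j ∧ j + l ≤ n + 1)) :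
    runInd n x j l = 0 :=
  if_neg fun h' => h ⟨h'.1, h'.2.1⟩

/-- The generator of the dynamics acts on the numbers of empty runs in triangular form. -/
lemma sum_runCount_parkStep_sub (n : ℕ) (x : Config) (k : ℕ) :
    ∑ i ∈ Finset.Icc 1 (n - 1), (runCount n (parkStep n x i) (k + 1) - runCount n x (k + 1)) =
      -(k * runCount n x (k + 1) + 2 * runCount n x (k + 2)) := by
  have h1 : ∀ j, ∑ i ∈ Finset.Icc 1 (n - 1),
      (if j ≤ i ∧ i < j + k then runInd n x j (k + 1) else 0) = k * runInd n x j (k + 1) := by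
    intro j
    by_cases hj : 1 ≤ j ∧ j + (k + 1) ≤ n + 1
    · rw [← Finset.sum_filter]
      have : (Finset.Icc 1 (n - 1)).filter (fun i => j ≤ i ∧ i < j + k) = Finset.Ico j (j + k) := by
        ext i
        simp only [Finset.mem_filter, Finset.mem_Icc, Finset.mem_Ico]
        omega
      simp [this]
    · simp [runInd_eq_zero hj]
  have h2 : ∑ j ∈ Finset.range (n + 1), ∑ i ∈ Finset.Icc 1 (n - 1),
      (if i + 1 = j then runInd n x i (k + 2) else 0) = runCount n x (k + 2) := by
    rw [Finset.sum_comm, runCount]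
    -- The starting points 0 and n carry no run of length at least 2.
    refine (Finset.sum_subset_zero_on_sdiff (fun i hi => ?_) (fun i hi => ?_) fun i hi => ?_)
    · simp only [Finset.mem_Icc, Finset.mem_range] at hi ⊢
      omega
    · simp only [Finset.mem_sdiff, Finset.mem_Icc, Finset.mem_range] at hi
      exact runInd_eq_zero (by omega)
    · simp only [Finset.mem_Icc] at hi
      rw [Finset.sum_ite_eq, if_pos (by simp only [Finset.mem_range]; omega)]
  have h3 : ∀ j, ∑ i ∈ Finset.Icc 1 (n - 1),
      (if i = j + k then runInd n x j (k + 2) else 0) = runInd n x j (k + 2) := by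
    intro j
    by_cases hj : 1 ≤ j ∧ j + (k + 2) ≤ n + 1
    · rw [Finset.sum_ite_eq', if_pos (by simp only [Finset.mem_Icc]; omega)]
    · simp [runInd_eq_zero hj]
  have key : ∑ i ∈ Finset.Icc 1 (n - 1), (runCount n x (k + 1) - runCount n (parkStep n x i) (k + 1))
      = k * runCount n x (k + 1) + 2 * runCount n x (k + 2) := by
    simp only [runCount, ← Finset.sum_sub_distrib, runInd_sub_parkStep]
    rw [Finset.sum_comm]
    simp only [Finset.sum_add_distrib, h1, h2, h3]
    simp only [runCount, ← Finset.mul_sum]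
    ring
  rw [← key, ← Finset.sum_neg_distrib]
  simp

/-! ### Bounds and special values of the run counts -/

lemma runInd_nonneg (n : ℕ) (x : Config) (j l : ℕ) : 0 ≤ runInd n x j l := by
  unfold runInd; split_ifs <;> norm_num

lemma runInd_le_one (n : ℕ) (x : Config) (j l : ℕ) : runInd n x j l ≤ 1 := by
  unfold runInd; split_ifs <;> norm_num

lemma runCount_nonneg (n : ℕ) (x : Config) (l : ℕ) : 0 ≤ runCount n x l :=
  Finset.sum_nonneg fun _ _ => runInd_nonneg _ _ _ _

lemma abs_runCount_le (n : ℕ) (x : Config) (l : ℕ) : |runCount n x l| ≤ n + 1 := by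
  rw [abs_of_nonneg (runCount_nonneg n x l), runCount]
  refine (Finset.sum_le_sum fun j _ => runInd_le_one n x j l).trans ?_
  simp

lemma runCount_eq_zero_of_lt {n l : ℕ} (x : Config) (h : n < l) : runCount n x l = 0 :=
  Finset.sum_eq_zero fun j _ => runInd_eq_zero (by omega)

lemma isFull_of_runCount_lt_one {n : ℕ} {x : Config} (h : runCount n x 2 < 1) : IsFull n x := by
  intro i hi
  have hr := canPark_iff_emptyRun.1 hi
  have : runInd n x i 2 ≤ runCount n x 2 :=
    Finset.single_le_sum (fun j _ => runInd_nonneg n x j 2)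
      (Finset.mem_range.2 (by have := hr.2.1; omega))
  rw [runInd, if_pos hr] at this
  linarith

lemma IsFull.runCount_eq_zero {n : ℕ} {x : Config} (h : IsFull n x) {l : ℕ} (hl : 2 ≤ l) :
    runCount n x l = 0 :=
  Finset.sum_eq_zero fun j _ => if_neg fun hr =>
    h j (canPark_iff_emptyRun.2 (hr.mono le_rfl (by omega)))

lemma runCount_empty (n k : ℕ) (hk : k < n) : runCount n (fun _ => false) (k + 1) = n - k := by
  classical
  have : ∀ j, runInd n (fun _ => false) j (k + 1) = if 1 ≤ j ∧ j + k ≤ n then (1 : ℝ) else 0 := by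
    intro j
    simp only [runInd, EmptyRun, implies_true, and_true]
    congr 1
    apply propext
    omega
  simp only [runCount, this]
  rw [← Finset.sum_filter]
  have : (Finset.range (n + 1)).filter (fun j => 1 ≤ j ∧ j + k ≤ n) = Finset.Icc 1 (n - k) := by
    ext i
    simp only [Finset.mem_filter, Finset.mem_Icc, Finset.mem_range]
    omega
  simp [this, Nat.cast_sub hk.le]

lemma runCount_one (n : ℕ) (x : Config) :
    runCount n x 1 = n - (((Finset.Icc 1 n).filter fun i => x i = true).card : ℝ) := by
  classical
  have h1 : ∀ j, runInd n x j 1 = if 1 ≤ j ∧ j ≤ n ∧ x j = false then (1 : ℝ) else 0 := by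
    intro j
    simp only [runInd, EmptyRun]
    congr 1
    apply propext
    constructor
    · rintro ⟨h1, h2, h3⟩
      exact ⟨h1, by omega, h3 j le_rfl (by omega)⟩
    · rintro ⟨h1, h2, h3⟩
      refine ⟨h1, by omega, fun i hi hi' => ?_⟩
      obtain rfl : i = j := by omega
      exact h3
  have h2 : (Finset.range (n + 1)).filter (fun j => 1 ≤ j ∧ j ≤ n ∧ x j = false)
      = (Finset.Icc 1 n).filter (fun i => ¬ x i = true) := by
    ext i
    simp only [Finset.mem_filter, Finset.mem_Icc, Finset.mem_range, Bool.not_eq_true]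
    grind
  have h3 := Finset.card_filter_add_card_filter_not (s := Finset.Icc 1 n) (fun i => x i = true)
  simp only [runCount, h1]
  rw [← Finset.sum_filter, h2]
  simp only [Finset.sum_const, nsmul_eq_mul, mul_one]
  rw [Nat.card_Icc, Nat.add_sub_cancel] at h3
  rw [eq_sub_iff_add_eq, add_comm]
  exact_mod_cast h3

/-! ### The harmonic potential -/

/-- The expected number of places that stay empty, as a function of the present configuration. -/
noncomputable def emptyPotential (n : ℕ) (x : Config) : ℝ :=
  ∑ k ∈ Finset.range n, (-2) ^ k / (k.factorial : ℝ) * runCount n x (k + 1)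

lemma sum_emptyPotential_parkStep_sub (n : ℕ) (x : Config) :
    ∑ i ∈ Finset.Icc 1 (n - 1), (emptyPotential n (parkStep n x i) - emptyPotential n x) = 0 := by
  -- With a_k = (-2)^k/k!, the relation (k+1) a_{k+1} = -2 a_k makes the sum telescope to one
  -- boundary term; for m = n it contains R_{n+1} = 0.
  have h : ∀ m : ℕ, ∑ k ∈ Finset.range m, (-2 : ℝ) ^ k / (k.factorial : ℝ) *
      (k * runCount n x (k + 1) + 2 * runCount n x (k + 2)) =
        -(m * ((-2) ^ m / (m.factorial : ℝ)) * runCount n x (m + 1)) := by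
    intro m
    induction m with
    | zero => simp
    | succ m ih =>
      have : ((m + 1 : ℕ) : ℝ) * ((-2) ^ (m + 1) / ((m + 1).factorial : ℝ))
          = -2 * ((-2) ^ m / (m.factorial : ℝ)) := by
        rw [Nat.factorial_succ]
        push_cast
        field_simp
        ring
      rw [Finset.sum_range_succ, ih, this]
      ring
  simp only [emptyPotential, ← Finset.sum_sub_distrib, ← mul_sub]
  rw [Finset.sum_comm]
  simp only [← Finset.mul_sum, sum_runCount_parkStep_sub, mul_neg, Finset.sum_neg_distrib]
  rw [h, runCount_eq_zero_of_lt x (Nat.lt_succ_self n)]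
  simp

lemma abs_emptyPotential_le (n : ℕ) (x : Config) :
    |emptyPotential n x| ≤ ∑ k ∈ Finset.range n, |(-2 : ℝ) ^ k / (k.factorial : ℝ)| * (n + 1) := by
  refine (Finset.abs_sum_le_sum_abs _ _).trans (Finset.sum_le_sum fun k _ => ?_)
  rw [abs_mul]
  exact mul_le_mul_of_nonneg_left (abs_runCount_le n x _) (abs_nonneg _)

lemma IsFull.emptyPotential_eq {n : ℕ} (hn : 1 ≤ n) {x : Config} (h : IsFull n x) :
    emptyPotential n x = runCount n x 1 := by
  rw [emptyPotential, Finset.sum_eq_single_of_mem 0 (Finset.mem_range.2 hn)]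
  · simp
  · intro k _ hk
    rw [h.runCount_eq_zero (by omega), mul_zero]

lemma emptyPotential_empty (n : ℕ) : emptyPotential n (fun _ => false) =
    ∑ k ∈ Finset.range n, (-2) ^ k / (k.factorial : ℝ) * (n - k) :=
  Finset.sum_congr rfl fun k hk => by rw [runCount_empty n k (Finset.mem_range.1 hk)]

/-! ### Absorption and dependence on the draws -/

lemma IsFull.parkStep_eq {n : ℕ} {x : Config} (h : IsFull n x) (i : ℕ) : parkStep n x i = x :=
  if_neg (h i)

lemma IsFull.config_eq {n : ℕ} {u : ℕ → ℕ} {t : ℕ} (h : IsFull n (config n u t)) {s : ℕ}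
    (hs : t ≤ s) : config n u s = config n u t := by
  induction s, hs using Nat.le_induction with
  | base => rfl
  | succ s _ ih => rw [config, ih, h.parkStep_eq]

/-- The hypothesis excludes the default value `sInf ∅ = 0`, which would give the empty
configuration. -/
lemma isFull_finalConfig {n : ℕ} {u : ℕ → ℕ} (h : ∃ t, IsFull n (config n u t)) :
    IsFull n (finalConfig n u) :=
  Nat.sInf_mem (s := {t | IsFull n (config n u t)}) h

lemma eventually_config_eq_finalConfig {n : ℕ} {u : ℕ → ℕ} (h : ∃ t, IsFull n (config n u t)) :
    ∀ᶠ t in atTop, config n u t = finalConfig n u :=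
  eventually_atTop.2 ⟨finalTime n u, fun _ ht => (isFull_finalConfig h).config_eq ht⟩

lemma config_congr {n : ℕ} {u v : ℕ → ℕ} {t : ℕ} (h : ∀ s < t, u s = v s) :
    config n u t = config n v t := by
  induction t with
  | zero => rfl
  | succ t ih =>
    rw [config, config, ih fun s hs => h s (by omega), h t (by omega)]


/-- The configuration at time `t` is a function of the first `t` draws. -/
lemma exists_config_eq_comp {Ω : Type*} (n : ℕ) (U : ℕ → Ω → ℕ) (t : ℕ) :
    ∃ Φ : (Finset.range t → ℕ) → Config,
      ∀ ω, config n (fun s => U s ω) t = Φ fun s => U s ω := by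
  refine ⟨fun v => config n (fun s => if h : s ∈ Finset.range t then v ⟨s, h⟩ else 0) t,
    fun ω => config_congr fun s hs => ?_⟩
  rw [dif_pos (Finset.mem_range.2 hs)]

/-! ### Expectations along the random draws -/

section Draws

variable {Ω : Type*} [MeasurableSpace Ω] {n : ℕ} {P : Measure Ω} {U : ℕ → Ω → ℕ}

/-- Finitely many integer draws range over a countable space, so no condition on `g` is needed. -/
lemma IsUniformDraws.measurable_comp_config (hU : IsUniformDraws n P U) (t : ℕ) (g : Config → ℝ) :
    Measurable fun ω => g (config n (fun s => U s ω) t) := by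
  obtain ⟨Φ, hΦ⟩ := exists_config_eq_comp n U t
  simp only [hΦ]
  exact (measurable_of_countable (g ∘ Φ)).comp (measurable_pi_lambda _ fun s => hU.measurable s)

lemma IsUniformDraws.indepFun_config (hU : IsUniformDraws n P U) (t : ℕ) (g : Config → ℝ)
    (f : ℕ → ℝ) :
    IndepFun (fun ω => f (U t ω)) (fun ω => g (config n (fun s => U s ω) t)) P := by
  obtain ⟨Φ, hΦ⟩ := exists_config_eq_comp n U t
  simp only [hΦ]
  have h := hU.indep.indepFun_finset {t} (Finset.range t) (by simp) hU.measurable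
  exact h.comp (φ := fun v : ({t} : Finset ℕ) → ℕ => f (v ⟨t, Finset.mem_singleton_self t⟩))
    (measurable_of_countable _) (measurable_of_countable (g ∘ Φ))

lemma IsUniformDraws.integral_indicator_draw (hU : IsUniformDraws n P U) (t : ℕ) {v : ℕ}
    (hv : v ∈ Finset.Icc 1 (n - 1)) :
    ∫ ω, (if U t ω = v then (1 : ℝ) else 0) ∂P = ((n - 1 : ℕ) : ℝ)⁻¹ := by
  have h1 : P (U t ⁻¹' {v}) = ((n - 1 : ℕ) : ENNReal)⁻¹ := by
    rw [← Measure.map_apply (hU.measurable t) (measurableSet_singleton v), hU.uniform t]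
    have := uniformOn_apply_finset (s := Finset.Icc 1 (n - 1)) (t := {v})
    rw [Finset.coe_Icc, Finset.coe_singleton, Finset.inter_singleton_of_mem hv] at this
    simpa using this
  have h2 : (fun ω => if U t ω = v then (1 : ℝ) else 0) = (U t ⁻¹' {v}).indicator 1 := by
    ext ω
    by_cases h : U t ω = v <;> simp [Set.indicator, h]
  rw [h2, integral_indicator_one (hU.measurable t (measurableSet_singleton v)), measureReal_def, h1,
    ENNReal.toReal_inv, ENNReal.toReal_natCast]

variable [IsProbabilityMeasure P]

lemma IsUniformDraws.integrable_comp_config (hU : IsUniformDraws n P U) (t : ℕ) {g : Config → ℝ}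
    {C : ℝ} (hg : ∀ x, |g x| ≤ C) :
    Integrable (fun ω => g (config n (fun s => U s ω) t)) P :=
  Integrable.of_bound (hU.measurable_comp_config t g).aestronglyMeasurable C
    (ae_of_all _ fun _ => hg _)

/-- One step of the dynamics, in expectation. -/
lemma IsUniformDraws.integral_config_succ (hU : IsUniformDraws n P U) (t : ℕ) {g : Config → ℝ}
    {C : ℝ} (hg : ∀ x, |g x| ≤ C) :
    ∫ ω, g (config n (fun s => U s ω) (t + 1)) ∂P =
      ∫ ω, g (config n (fun s => U s ω) t) ∂P + ((n - 1 : ℕ) : ℝ)⁻¹ *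
        ∫ ω, ∑ v ∈ Finset.Icc 1 (n - 1), (g (parkStep n (config n (fun s => U s ω) t) v)
          - g (config n (fun s => U s ω) t)) ∂P := by
  -- Splitting over the value of the draw separates `U t` from the present configuration, so that
  -- independence factors each expectation.
  have hstep : ∀ (x : Config) (i : ℕ), g (parkStep n x i) = g x + ∑ v ∈ Finset.Icc 1 (n - 1),
      (if i = v then (1 : ℝ) else 0) * (g (parkStep n x v) - g x) := by
    intro x i
    simp only [ite_mul, one_mul, zero_mul, Finset.sum_ite_eq]
    split_ifs with h
    · ring
    · rw [parkStep, if_neg fun hc => h (Finset.mem_Icc.2 ⟨hc.1.1, Nat.le_sub_one_of_lt hc.1.2⟩)]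
      ring
  have hd : ∀ v x, |g (parkStep n x v) - g x| ≤ C + C := fun v x =>
    (abs_sub _ _).trans (add_le_add (hg _) (hg _))
  have hi : ∀ v, Integrable (fun ω => g (parkStep n (config n (fun s => U s ω) t) v)
      - g (config n (fun s => U s ω) t)) P := fun v =>
    hU.integrable_comp_config t (g := fun x => g (parkStep n x v) - g x) (hd v)
  have hm : ∀ v, Measurable fun ω => if U t ω = v then (1 : ℝ) else 0 := fun v =>
    (measurable_of_countable fun i : ℕ => if i = v then (1 : ℝ) else 0).comp (hU.measurable t)
  have hp : ∀ v, Integrable (fun ω => (if U t ω = v then (1 : ℝ) else 0) *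
      (g (parkStep n (config n (fun s => U s ω) t) v) - g (config n (fun s => U s ω) t))) P :=
    fun v => (hi v).bdd_mul (c := 1) (hm v).aestronglyMeasurable
      (ae_of_all _ fun ω => by split_ifs <;> simp)
  simp only [config, hstep _ (U t _)]
  rw [integral_add (hU.integrable_comp_config t hg) (integrable_finsetSum _ fun v _ => hp v),
    integral_finsetSum _ fun v _ => hp v, integral_finsetSum _ fun v _ => hi v, Finset.mul_sum]
  congr 1
  refine Finset.sum_congr rfl fun v hv => ?_
  rw [← hU.integral_indicator_draw t hv]
  exact (hU.indepFun_config t (fun x => g (parkStep n x v) - g x)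
    (fun i => if i = v then (1 : ℝ) else 0)).integral_fun_mul_eq_mul_integral
    (hm v).aestronglyMeasurable (hi v).aestronglyMeasurable

lemma IsUniformDraws.integral_emptyPotential (hU : IsUniformDraws n P U) (t : ℕ) :
    ∫ ω, emptyPotential n (config n (fun s => U s ω) t) ∂P =
      emptyPotential n fun _ => false := by
  induction t with
  | zero => simp [config]
  | succ t ih =>
    rw [hU.integral_config_succ t (abs_emptyPotential_le n), ih]
    simp only [sum_emptyPotential_parkStep_sub, integral_zero, mul_zero, add_zero]

/-- E[R_1] starts at n, loses 2 E[R_2]/(n-1) at each step and stays nonnegative. -/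
lemma IsUniformDraws.sum_integral_runCount_two_le (hn : 2 ≤ n) (hU : IsUniformDraws n P U)
    (t : ℕ) :
    ∑ s ∈ Finset.range t, ∫ ω, runCount n (config n (fun r => U r ω) s) 2 ∂P ≤
      (n - 1 : ℕ) * n / 2 := by
  have hpos : (0 : ℝ) < ((n - 1 : ℕ) : ℝ) := by
    rw [Nat.cast_pos]
    omega
  have h : ∀ t, ∫ ω, runCount n (config n (fun r => U r ω) t) 1 ∂P = n - ((n - 1 : ℕ) : ℝ)⁻¹ * 2 *
      ∑ s ∈ Finset.range t, ∫ ω, runCount n (config n (fun r => U r ω) s) 2 ∂P := by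
    intro t
    induction t with
    | zero =>
      have := runCount_empty n 0 (by omega)
      simp only [zero_add] at this
      simp [config, this]
    | succ t ih =>
      have := hU.integral_config_succ t (g := fun x => runCount n x 1)
        (fun x => abs_runCount_le n x 1)
      simp only [sum_runCount_parkStep_sub n _ 0, Nat.cast_zero, zero_mul, zero_add,
        integral_neg, integral_const_mul] at this
      rw [this, ih, Finset.sum_range_succ]
      ring
  have h0 : 0 ≤ ∫ ω, runCount n (config n (fun r => U r ω) t) 1 ∂P :=
    integral_nonneg fun ω => runCount_nonneg _ _ _
  rw [h t] at h0
  rw [le_div_iff₀ two_pos, ← inv_mul_le_iff₀ hpos]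
  linarith

lemma IsUniformDraws.ae_exists_isFull (hn : 2 ≤ n) (hU : IsUniformDraws n P U) :
    ∀ᵐ ω ∂P, ∃ t, IsFull n (config n (fun s => U s ω) t) := by
  have hs : Summable fun t => ∫ ω, runCount n (config n (fun r => U r ω) t) 2 ∂P :=
    summable_of_sum_range_le (fun t => integral_nonneg fun ω => runCount_nonneg _ _ _)
      (hU.sum_integral_runCount_two_le hn)
  have hle : ∀ t, P.real {ω | 1 ≤ runCount n (config n (fun r => U r ω) t) 2} ≤
      ∫ ω, runCount n (config n (fun r => U r ω) t) 2 ∂P := by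
    intro t
    have := mul_meas_ge_le_integral_of_nonneg (μ := P)
      (ae_of_all _ fun ω => runCount_nonneg n (config n (fun r => U r ω) t) 2)
      (hU.integrable_comp_config t (g := fun x => runCount n x 2)
        fun x => abs_runCount_le n x 2) 1
    simpa using this
  -- By Markov, P(R_2 ≥ 1) at time t is at most E[R_2], which tends to 0 by summability; never being
  -- full forces R_2 ≥ 1 at every t.
  have hzero : P.real {ω | ¬ ∃ t, IsFull n (config n (fun s => U s ω) t)} ≤ 0 := by
    refine ge_of_tendsto' hs.tendsto_atTop_zero fun t => (measureReal_mono ?_).trans (hle t)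
    intro ω hω
    by_contra hlt
    exact hω ⟨t, isFull_of_runCount_lt_one (not_le.1 hlt)⟩
  rw [ae_iff, ← measureReal_eq_zero_iff]
  exact hzero.antisymm measureReal_nonneg

lemma IsUniformDraws.ae_tendsto_emptyPotential (hn : 2 ≤ n) (hU : IsUniformDraws n P U) :
    ∀ᵐ ω ∂P, Tendsto (fun t => emptyPotential n (config n (fun s => U s ω) t)) atTop
      (𝓝 ((n : ℝ) - occupied n fun s => U s ω)) := by
  filter_upwards [hU.ae_exists_isFull hn] with ω hω
  refine tendsto_const_nhds.congr' ?_
  filter_upwards [eventually_config_eq_finalConfig hω] with t ht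
  rw [ht, (isFull_finalConfig hω).emptyPotential_eq (by omega), runCount_one, occupied]

lemma IsUniformDraws.integrable_occupied (hn : 2 ≤ n) (hU : IsUniformDraws n P U) :
    Integrable (fun ω => (occupied n (fun s => U s ω) : ℝ)) P := by
  -- Measurability is inherited from the almost sure limit of the potential, without studying the
  -- final time.
  have hm : AEStronglyMeasurable (fun ω => (n : ℝ) - occupied n fun s => U s ω) P :=
    aestronglyMeasurable_of_tendsto_ae atTop
      (fun t => (hU.measurable_comp_config t (emptyPotential n)).aestronglyMeasurable)
      (hU.ae_tendsto_emptyPotential hn)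
  have hm' : AEStronglyMeasurable (fun ω => (occupied n (fun s => U s ω) : ℝ)) P := by
    convert (aestronglyMeasurable_const (b := (n : ℝ))).sub hm using 1
    ext ω
    simp
  refine Integrable.of_bound hm' n (ae_of_all _ fun ω => ?_)
  rw [Real.norm_natCast, Nat.cast_le, occupied]
  refine (Finset.card_filter_le _ _).trans ?_
  simp

lemma IsUniformDraws.integral_occupied (hn : 2 ≤ n) (hU : IsUniformDraws n P U) :
    ∫ ω, (occupied n (fun s => U s ω) : ℝ) ∂P =
      n - ∑ k ∈ Finset.range n, (-2) ^ k / (k.factorial : ℝ) * (n - k) := by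
  have h := tendsto_integral_of_dominated_convergence
    (fun _ => ∑ k ∈ Finset.range n, |(-2 : ℝ) ^ k / (k.factorial : ℝ)| * (n + 1))
    (fun t => (hU.measurable_comp_config t (emptyPotential n)).aestronglyMeasurable)
    (integrable_const _) (fun t => ae_of_all _ fun ω => abs_emptyPotential_le n _)
    (hU.ae_tendsto_emptyPotential hn)
  -- The converging expectations are constant in t, so their limit is the initial potential.
  simp only [hU.integral_emptyPotential] at h
  have h' := tendsto_nhds_unique h tendsto_const_nhds
  rw [integral_sub (integrable_const _) (hU.integrable_occupied hn), emptyPotential_empty] at h'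
  rw [← h']
  simp

end Draws

/-! ### Comparison with the exponential series -/

lemma hasSum_min_mul_neg_two_pow (n : ℕ) :
    HasSum (fun k : ℕ => (min k n : ℕ) * ((-2 : ℝ) ^ k / (k.factorial : ℝ)))
      (n * Real.exp (-2) - ∑ k ∈ Finset.range n, (-2 : ℝ) ^ k / (k.factorial : ℝ) * (n - k)) := by
  have h1 : HasSum (fun k : ℕ => (-2 : ℝ) ^ k / (k.factorial : ℝ)) (Real.exp (-2)) := by
    rw [Real.exp_eq_exp_ℝ]
    exact NormedSpace.expSeries_div_hasSum_exp (-2 : ℝ)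
  have h2 := hasSum_sum_of_ne_finset_zero (L := .unconditional ℕ)
    (f := fun k : ℕ => (-2 : ℝ) ^ k / (k.factorial : ℝ) * ((n - k : ℕ) : ℝ))
    (s := Finset.range n) (fun k hk => by
      rw [Finset.mem_range, not_lt] at hk
      simp [Nat.sub_eq_zero_of_le hk])
  have h3 := (h1.mul_left (n : ℝ)).sub h2
  have hf : ∀ k : ℕ, (min k n : ℕ) * ((-2 : ℝ) ^ k / (k.factorial : ℝ)) =
      n * ((-2 : ℝ) ^ k / (k.factorial : ℝ)) -
        (-2 : ℝ) ^ k / (k.factorial : ℝ) * ((n - k : ℕ) : ℝ) := by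
    intro k
    have h : min k n + (n - k) = n := by omega
    have h' : ((min k n : ℕ) : ℝ) + ((n - k : ℕ) : ℝ) = n := by exact_mod_cast h
    rw [← h']
    ring
  have hv : ∑ k ∈ Finset.range n, (-2 : ℝ) ^ k / (k.factorial : ℝ) * (n - k) =
      ∑ k ∈ Finset.range n, (-2 : ℝ) ^ k / (k.factorial : ℝ) * ((n - k : ℕ) : ℝ) :=
    Finset.sum_congr rfl fun k hk => by rw [Nat.cast_sub (Finset.mem_range.1 hk).le]
  rw [funext hf, hv]
  exact h3

/-- In the series ∑ min(k,n) (-2)^k/k!, the terms k = 0, 1, 2 add up to 0 - 2 + 4 = 2. The rest is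
at most ∑_{k≥3} k 2^k/k! = 2(e² - 3) ≤ 10, using e² ≤ 8. Taking absolute values from the start would
only give 2e² > 12. -/
lemma abs_mul_exp_sub_sum_le {n : ℕ} (hn : 2 ≤ n) :
    |n * Real.exp (-2) - ∑ k ∈ Finset.range n, (-2 : ℝ) ^ k / (k.factorial : ℝ) * (n - k)|
      ≤ 12 := by
  have h := (hasSum_nat_add_iff' 3).2 (hasSum_min_mul_neg_two_pow n)
  have h2 : HasSum (fun k : ℕ => 2 * ((2 : ℝ) ^ k / (k.factorial : ℝ))) (2 * Real.exp 2) := by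
    rw [Real.exp_eq_exp_ℝ]
    exact (NormedSpace.expSeries_div_hasSum_exp (2 : ℝ)).mul_left 2
  have h3 := (hasSum_nat_add_iff' 2).2 h2
  have hle := tsum_of_norm_bounded h3 (f := fun k : ℕ => (min (k + 3) n : ℕ) *
    ((-2 : ℝ) ^ (k + 3) / ((k + 3).factorial : ℝ))) (fun k => by
      rw [norm_mul, norm_div, norm_pow]
      simp only [norm_neg, Real.norm_ofNat, Real.norm_natCast]
      calc ((min (k + 3) n : ℕ) : ℝ) * (2 ^ (k + 3) / ((k + 3).factorial : ℝ))
          ≤ ((k + 3 : ℕ) : ℝ) * (2 ^ (k + 3) / ((k + 3).factorial : ℝ)) := by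
            gcongr
            exact min_le_left _ _
        _ = 2 * (2 ^ (k + 2) / ((k + 2).factorial : ℝ)) := by
            rw [Nat.factorial_succ (k + 2)]
            push_cast
            field_simp
            ring)
  rw [h.tsum_eq] at hle
  simp only [Finset.sum_range_succ, Finset.sum_range_zero, Real.norm_eq_abs,
    min_eq_left (show 1 ≤ n by omega), min_eq_left hn, Nat.zero_min] at hle
  norm_num [Nat.factorial] at hle
  have he : Real.exp 2 ≤ 8 := by
    have := Real.exp_one_lt_d9
    rw [show (2 : ℝ) = 1 + 1 by norm_num, Real.exp_add]
    nlinarith [Real.exp_pos 1]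
  rw [abs_le] at hle ⊢
  constructor <;> linarith [hle.1, hle.2]
end PageParking
theorem mainTheorem1 {Ω : ℕ → Type*} [∀ n, MeasurableSpace (Ω n)]
    (P : ∀ n, Measure (Ω n)) [∀ n, IsProbabilityMeasure (P n)]
    (U : ∀ n, ℕ → Ω n → ℕ)
    (hU : ∀ n, 2 ≤ n → PageParking.IsUniformDraws n (P n) (U n)) :
    (∀ n, 2 ≤ n →
      (∀ᵐ ω ∂(P n), ∃ t, PageParking.IsFull n (PageParking.config n (fun s => U n s ω) t)) ∧
      Integrable (fun ω => (PageParking.occupied n (fun s => U n s ω) : ℝ)) (P n) ∧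
      |(∫ ω, (PageParking.occupied n (fun s => U n s ω) : ℝ) ∂(P n))
          - (n : ℝ) * (1 - Real.exp (-2))| ≤ 12) ∧
    Tendsto
      (fun n : ℕ => (∫ ω, (PageParking.occupied n (fun s => U n s ω) : ℝ) ∂(P n)) / (n : ℝ))
      atTop (𝓝 (1 - Real.exp (-2))) := by
  have hbound : ∀ n, 2 ≤ n →
      |(∫ ω, (PageParking.occupied n (fun s => U n s ω) : ℝ) ∂(P n))
          - (n : ℝ) * (1 - Real.exp (-2))| ≤ 12 := by
    intro n hn
    rw [(hU n hn).integral_occupied hn]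
    convert PageParking.abs_mul_exp_sub_sum_le hn using 2
    ring
  refine ⟨fun n hn => ⟨(hU n hn).ae_exists_isFull hn, (hU n hn).integrable_occupied hn,
    hbound n hn⟩, ?_⟩
  rw [tendsto_iff_norm_sub_tendsto_zero]
  refine squeeze_zero' (.of_forall fun _ => norm_nonneg _) ?_
    (tendsto_const_div_atTop_nhds_zero_nat 12)
  filter_upwards [eventually_ge_atTop 2] with n hn
  have hpos : (0 : ℝ) < n := by
    rw [Nat.cast_pos]
    omega
  rw [Real.norm_eq_abs, div_sub' hpos.ne', abs_div, abs_of_pos hpos]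
  exact div_le_div_of_nonneg_right (hbound n hn) hpos.le
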